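/- Let $n\geq 2$, and let $D_n\subseteq\mathbb{Q}^n$ be dense in the usual product topology on $\mathbb{Q}^n$ and such that no two distinct points of $D_n$ share a coordinate. Let $\mathbf{D}_{n,<_1,\ldots,<_n}=(D_n,<,<_1,\ldots,<_n)$, where $<$ is the product order ($\mathbf{a}<\mathbf{b}$ if and only if $\mathbf{a}\neq\mathbf{b}$ and $a_i\leq b_i$ for all $i\leq n$) and $<_i$ is the $i$th coordinate order ($\mathbf{a}<_i\mathbf{b}$ if and only if $a_i<b_i$). Then the group $\mathrm{Aut}(\mathbf{D}_{n,<_1,\ldots,<_n})$ of all bijections $g:D_n\to D_n$ such that $g$ and $g^{-1}$ preserve $<,<_1,\ldots,<_n$, with the topology of pointwise convergence (the one induced from the product topology on $D_n^{D_n}$ with $D_n$ discrete), is extremely amenable: every continuous action $\mathrm{Aut}(\mathbf{D}_{n,<_1,\ldots,<_n})\times X\to X$ on a non-empty compact Hausdorff space $X$ has a fixed point, that is, a point $x\in X$ with $g\cdot x=x$ for all $g$. -/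

import Mathlib

universe u v

/-- A subset `D` of `ℚ ^ n` in which no two distinct points are colinear, that is, share a
coordinate. -/
def NoColinear {n : ℕ} (D : Set (Fin n → ℚ)) : Prop :=
  ∀ a ∈ D, ∀ b ∈ D, a ≠ b → ∀ i : Fin n, a i ≠ b i

/-- The relations of the structure `(D, <, <₁, …, <ₙ)` on a subset `D` of `ℚ ^ n`: the relation
with index `0` is the strict product order (`a ≤ b` coordinatewise and `a ≠ b`), the one with
index `i + 1` is the `i`-th coordinate order. -/
def orderRel {n : ℕ} (D : Set (Fin n → ℚ)) : Fin (n + 1) → D → D → Prop :=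
  Fin.cons (fun a b => (∀ j : Fin n, a.1 j ≤ b.1 j) ∧ a ≠ b) (fun i a b => a.1 i < b.1 i)

/-- The group of automorphisms of a structure `(A, (R i)_i)` with binary relations `R i`: all
bijections of `A` that preserve and reflect every relation; the product is composition. -/
def autGroup {ι A : Type*} (R : ι → A → A → Prop) : Subgroup (Equiv.Perm A) where
  carrier := {g | ∀ i a b, R i a b ↔ R i (g a) (g b)}
  mul_mem' := by
    intro g h hg hh i a b
    exact (hh i a b).trans (hg i (h a) (h b))
  one_mem' := fun _ _ _ => Iff.rfl
  inv_mem' := by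
    intro g hg i a b
    have := hg i (g⁻¹ a) (g⁻¹ b)
    simpa using this.symm

/-- The topology of pointwise convergence on the automorphism group of a structure with underlying
set `A`: the topology induced from the product topology on `A → A`, where `A` is discrete
(whatever other topology `A` may carry). -/
instance autGroup.instTopologicalSpace {ι A : Type*} (R : ι → A → A → Prop) :
    TopologicalSpace (autGroup R) :=
  TopologicalSpace.induced (fun (g : autGroup R) (a : A) => g.1 a)
    (@Pi.topologicalSpace A (fun _ => A) (fun _ => ⊥))

theorem autGroup.isOpen_setOf_apply_eq {ι A : Type*} (R : ι → A → A → Prop) (a b : A) :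
    IsOpen {g : autGroup R | g.1 a = b} := by
  let _ : TopologicalSpace A := ⊥
  have : DiscreteTopology A := ⟨rfl⟩
  have hc : Continuous (fun (g : autGroup R) (a : A) => g.1 a) := continuous_induced_dom
  exact (isOpen_discrete {b}).preimage ((continuous_apply a).comp hc)

theorem autGroup.continuous_of_isOpen {ι A Y : Type*} [TopologicalSpace Y]
    (R : ι → A → A → Prop) (f : Y → autGroup R)
    (hf : ∀ a b : A, IsOpen {y | (f y).1 a = b}) : Continuous f := by
  let _ : TopologicalSpace A := ⊥
  have : DiscreteTopology A := ⟨rfl⟩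
  refine continuous_induced_rng.2 (continuous_pi fun a => ?_)
  exact continuous_discrete_rng.2 fun b => hf a b

instance autGroup.instIsTopologicalGroup {ι A : Type*} (R : ι → A → A → Prop) :
    IsTopologicalGroup (autGroup R) where
  continuous_mul := by
    refine autGroup.continuous_of_isOpen R _ fun a b => ?_
    have h : {p : autGroup R × autGroup R | (p.1 * p.2).1 a = b} =
        ⋃ c : A, {g : autGroup R | g.1 c = b} ×ˢ {g : autGroup R | g.1 a = c} := by
      ext p
      simp
    rw [h]
    exact isOpen_iUnion fun c =>
      (autGroup.isOpen_setOf_apply_eq R c b).prod (autGroup.isOpen_setOf_apply_eq R a c)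
  continuous_inv := by
    refine autGroup.continuous_of_isOpen R _ fun a b => ?_
    have h : {g : autGroup R | (g⁻¹).1 a = b} = {g : autGroup R | g.1 b = a} := by
      ext g
      exact Equiv.Perm.inv_eq_iff_eq.trans eq_comm
    rw [h]
    exact autGroup.isOpen_setOf_apply_eq R b a

instance autGroup.instT2Space {ι A : Type*} (R : ι → A → A → Prop) : T2Space (autGroup R) := by
  let _ : TopologicalSpace A := ⊥
  have : DiscreteTopology A := ⟨rfl⟩
  refine T2Space.of_injective_continuous (f := fun (g : autGroup R) (a : A) => g.1 a) ?_
    continuous_induced_dom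
  intro g h hgh
  exact Subtype.ext (Equiv.ext fun a => congrFun hgh a)

/-- A Hausdorff topological group `G` is extremely amenable if every (jointly) continuous action
of `G` on a non-empty compact Hausdorff space has a fixed point. -/
def ExtremelyAmenable (G : Type u) [Group G] [TopologicalSpace G] [IsTopologicalGroup G]
    [T2Space G] : Prop :=
  ∀ (X : Type v) [TopologicalSpace X] [CompactSpace X] [T2Space X] [Nonempty X]
    [MulAction G X] [ContinuousSMul G X], ∃ x : X, ∀ g : G, g • x = x

open Filter Topology Uniformity

/-! ### The finite Ramsey theorem for hypergraphs -/

/-! By compactness, a fixed point exists once every finite set of group elements has a common almost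
fixed point for each entourage. Inside an orbit this follows from a Ramsey statement: if a finite
colouring of the group depends only on the restriction of `g` to a finite `S`, then some translate
`h * F` of a given finite `F` is monochromatic (`extremelyAmenable_autGroup_of_ramsey`).

For `D` the Ramsey statement reduces to the classical finite Ramsey theorem
(`exists_constant_translate`). A copy of `S` in a grid inside `D` is given by `n` increasing lists
of indices; separate blocks of one set of `n * |S|` naturals supply these lists. The translating `h`
comes from homogeneity, proved by back-and-forth (`IsPartialIso.exists_autGroup`). -/

theorem Ultrafilter.exists_eventually_eq {α κ : Type*} [Finite κ] (U : Ultrafilter α)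
    (f : α → κ) : ∃ q, ∀ᶠ y in (U : Filter α), f y = q := by
  obtain ⟨q, hq⟩ := Ultrafilter.eq_pure_of_finite (U.map f)
  refine ⟨q, ?_⟩
  have : {q} ∈ U.map f := by rw [hq]; exact Ultrafilter.mem_pure.2 rfl
  exact this

theorem exists_homogeneous_finset {κ : Type*} [Finite κ] (k : ℕ) (c : Finset ℕ → κ) (N : ℕ) :
    ∃ (T : Finset ℕ) (q : κ), T.card = N ∧ ∀ s ⊆ T, s.card = k → c s = q := by
  classical
  let U : Ultrafilter ℕ := hyperfilter ℕ
  choose lim hlim using fun f : ℕ → κ => U.exists_eventually_eq f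
  -- `L j s` is the colour of `s` after adding `j` generic points, as an iterated ultrafilter limit.
  let L : ℕ → Finset ℕ → κ := fun j => Nat.rec c (fun _ M s => lim fun y => M (insert y s)) j
  have hL : ∀ j s, ∀ᶠ y in (U : Filter ℕ), L j (insert y s) = L (j + 1) s :=
    fun j s => hlim fun y => L j (insert y s)
  suffices h : ∃ T : Finset ℕ, T.card = N ∧
      ∀ s ⊆ T, ∀ j, s.card + j = k → L j s = L k ∅ by
    obtain ⟨T, hT, h⟩ := h
    exact ⟨T, L k ∅, hT, fun s hs hk => h s hs 0 hk⟩
  induction N with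
  | zero =>
    refine ⟨∅, rfl, fun s hs j hj => ?_⟩
    obtain rfl := Finset.subset_empty.1 hs
    rw [← hj]
    simp
  | succ N ih =>
    obtain ⟨T, hT, h⟩ := ih
    have h1 : ∀ᶠ y in (U : Filter ℕ), y ∉ T := by
      have := T.finite_toSet.compl_mem_hyperfilter
      exact this
    have h2 : ∀ᶠ y in (U : Filter ℕ), ∀ s ∈ T.powerset, ∀ j ∈ Finset.range k,
        L j (insert y s) = L (j + 1) s := by
      rw [Filter.eventually_all_finset]
      intro s _
      rw [Filter.eventually_all_finset]
      exact fun j _ => hL j s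
    obtain ⟨y, hyT, hy⟩ := (h1.and h2).exists
    refine ⟨insert y T, by rw [Finset.card_insert_of_notMem hyT, hT], fun s hs j hj => ?_⟩
    by_cases hys : y ∈ s
    · have hsub : s.erase y ⊆ T := Finset.subset_insert_iff.1 hs
      have hcard := Finset.card_erase_add_one hys
      have := hy (s.erase y) (Finset.mem_powerset.2 hsub) j (Finset.mem_range.2 (by omega))
      rw [Finset.insert_erase hys] at this
      rw [this]
      exact h _ hsub (j + 1) (by omega)
    · exact h s ((Finset.subset_insert_iff_of_notMem hys).1 hs) j hj

theorem exists_homogeneous_strictMono {κ : Type*} [Finite κ] (k N : ℕ) (c : (Fin k → ℕ) → κ) :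
    ∃ (t : Fin N → ℕ) (q : κ), StrictMono t ∧
      ∀ s : Fin k → Fin N, StrictMono s → c (t ∘ s) = q := by
  classical
  obtain ⟨T, q, hT, h⟩ := exists_homogeneous_finset k
    (fun s : Finset ℕ => if hs : s.card = k then c (s.orderEmbOfFin hs) else c fun _ => 0) N
  refine ⟨T.orderEmbOfFin hT, q, (T.orderEmbOfFin hT).strictMono, fun s hs => ?_⟩
  have hmono : StrictMono (T.orderEmbOfFin hT ∘ s) := (T.orderEmbOfFin hT).strictMono.comp hs
  have hcard : (Finset.univ.image (T.orderEmbOfFin hT ∘ s)).card = k := by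
    rw [Finset.card_image_of_injective _ hmono.injective, Finset.card_fin]
  have hq := h (Finset.univ.image (T.orderEmbOfFin hT ∘ s))
    (Finset.image_subset_iff.2 fun i _ => Finset.orderEmbOfFin_mem T hT (s i)) hcard
  rw [dif_pos hcard] at hq
  rw [← hq]
  congr 1
  exact Finset.orderEmbOfFin_unique hcard
    (fun i => Finset.mem_image_of_mem _ (Finset.mem_univ i)) hmono

/-! ### Extreme amenability from a Ramsey property -/

theorem eventually_nhds_one_forall_smul_mem {G X : Type*} [Group G] [TopologicalSpace G]
    [UniformSpace X] [CompactSpace X] [MulAction G X] [ContinuousSMul G X]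
    {U : Set (X × X)} (hU : U ∈ 𝓤 X) : ∀ᶠ g in 𝓝 (1 : G), ∀ x : X, (x, g • x) ∈ U := by
  have h : ∀ᶠ g in 𝓝 (1 : G), ∀ x ∈ (Set.univ : Set X), (x, g • x) ∈ U := by
    refine isCompact_univ.eventually_forall_of_forall_eventually fun x _ => ?_
    have hc : ContinuousAt (fun p : G × X => (p.2, p.1 • p.2)) (1, x) := by fun_prop
    refine hc.eventually ?_
    simp only [one_smul]
    exact nhds_le_uniformity x hU
  exact h.mono fun g hg x => hg x trivial

theorem autGroup.exists_finset_of_mem_nhds_one {ι A : Type*} (R : ι → A → A → Prop)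
    {V : Set (autGroup R)} (hV : V ∈ 𝓝 (1 : autGroup R)) :
    ∃ S : Finset A, ∀ g : autGroup R, (∀ a ∈ S, g.1 a = a) → g ∈ V := by
  let _ : TopologicalSpace A := ⊥
  have : DiscreteTopology A := ⟨rfl⟩
  rw [nhds_induced, Filter.mem_comap] at hV
  obtain ⟨W, hW, hWV⟩ := hV
  rw [nhds_pi, Filter.mem_pi] at hW
  obtain ⟨I, hI, t, ht, hIt⟩ := hW
  refine ⟨hI.toFinset, fun g hg => hWV (hIt fun a ha => ?_)⟩
  have h1 := mem_of_mem_nhds (ht a)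
  have h2 := hg a (hI.mem_toFinset.2 ha)
  change g.1 a ∈ t a
  rw [h2]
  exact h1

theorem extremelyAmenable_autGroup_of_ramsey {ι : Type*} {A : Type u} (R : ι → A → A → Prop)
    (H : ∀ (S : Finset A) (F : Finset (autGroup R)) (κ : Type v) [Finite κ]
      (c : autGroup R → κ), (∀ g g' : autGroup R, (∀ a ∈ S, g.1 a = g'.1 a) → c g = c g') →
      ∃ (h : autGroup R) (q : κ), ∀ g ∈ F, c (h * g) = q) :
    ExtremelyAmenable.{u, v} (autGroup R) := by
  classical
  intro X _ _ _ _ _ _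
  let _ : UniformSpace X := uniformSpaceOfCompactR1
  obtain ⟨x₀⟩ := ‹Nonempty X›
  have key : ∀ (F : Finset (autGroup R)) (U : Set (X × X)), U ∈ 𝓤 X →
      ∃ x : X, ∀ g ∈ F, (g • x, x) ∈ U := by
    intro F U hU
    obtain ⟨W, hW, hWsymm, hWU⟩ := comp_symm_mem_uniformity_sets hU
    obtain ⟨V, hV, hVsymm, hVW⟩ := comp_symm_mem_uniformity_sets hW
    obtain ⟨S, hS⟩ := autGroup.exists_finset_of_mem_nhds_one R
      (eventually_nhds_one_forall_smul_mem (X := X) hV)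
    obtain ⟨t, htfin, ht⟩ := (isCompact_univ (X := X)).totallyBounded V hV
    have hcov : ∀ x : X, ∃ y : t, (x, y.1) ∈ V := by
      intro x
      have := ht (Set.mem_univ x)
      simp only [Set.mem_iUnion] at this
      obtain ⟨y, hy, hxy⟩ := this
      exact ⟨⟨y, hy⟩, hxy⟩
    choose idx hidx using hcov
    have : Finite t := htfin
    let rest (g : autGroup R) : S → A := fun a => g.1 a
    -- A representative depending only on `g` restricted to `S`, so that the colour `c` does too.
    let rep : autGroup R → autGroup R := fun g => Function.invFun rest (rest g)
    have hrep : ∀ g, rest (rep g) = rest g := fun g => Function.invFun_eq ⟨g, rfl⟩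
    let c : autGroup R → t := fun g => idx ((rep g)⁻¹ • x₀)
    have hc : ∀ g : autGroup R, (g⁻¹ • x₀, (c g).1) ∈ W := by
      intro g
      refine hVW ⟨(rep g)⁻¹ • x₀, ?_, hidx _⟩
      have hmem : (rep g)⁻¹ * g ∈ {v : autGroup R | ∀ x : X, (x, v • x) ∈ V} := by
        refine hS _ fun a ha => ?_
        have := congrFun (hrep g) ⟨a, ha⟩
        change (rep g).1⁻¹ (g.1 a) = a
        rw [Equiv.Perm.inv_eq_iff_eq]
        exact this.symm
      have := hmem (g⁻¹ • x₀)
      rwa [mul_smul, smul_inv_smul] at this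
    -- The colour of `h * g⁻¹` locates `g • h⁻¹ • x₀`; the element `1` adds `h⁻¹ • x₀` itself for
    -- comparison.
    obtain ⟨h, q, hq⟩ := H S (insert 1 (F.image (·⁻¹))) t c (fun g g' hgg => by
      have : rest g = rest g' := funext fun a => hgg a a.2
      simp only [c, rep, this])
    refine ⟨h⁻¹ • x₀, fun g hg => hWU ⟨q.1, ?_, ?_⟩⟩
    · have := hc (h * g⁻¹)
      rwa [hq _ (Finset.mem_insert_of_mem (Finset.mem_image_of_mem _ hg)), mul_inv_rev, inv_inv,
        mul_smul] at this
    · have := hc (h * 1)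
      rw [hq _ (Finset.mem_insert_self _ _), mul_one] at this
      exact hWsymm.symm _ _ this
  let Z : Finset (autGroup R) × {U : Set (X × X) // U ∈ 𝓤 X ∧ IsClosed U} → Set X :=
    fun p => {x | ∀ g ∈ p.1, (g • x, x) ∈ p.2.1}
  have hZc : ∀ p, IsClosed (Z p) := by
    intro p
    simp only [Z, Set.ofPred_forall]
    exact isClosed_biInter fun g _ => p.2.2.2.preimage
      ((continuous_const_smul g).prodMk continuous_id)
  have hZ : (⋂ p, Z p).Nonempty := by
    have : Nonempty {U : Set (X × X) // U ∈ 𝓤 X ∧ IsClosed U} :=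
      ⟨⟨Set.univ, univ_mem, isClosed_univ⟩⟩
    refine IsCompact.nonempty_iInter_of_directed_nonempty_isCompact_isClosed Z ?_ ?_ ?_ ?_
    · rintro ⟨F, U, hU, hUc⟩ ⟨F', U', hU', hUc'⟩
      exact ⟨⟨F ∪ F', U ∩ U', inter_mem hU hU', hUc.inter hUc'⟩,
        fun x hx g hg => (hx g (Finset.mem_union_left _ hg)).1,
        fun x hx g hg => (hx g (Finset.mem_union_right _ hg)).2⟩
    · exact fun p => key p.1 p.2.1 p.2.2.1
    · exact fun p => (hZc p).isCompact
    · exact hZc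
  obtain ⟨x, hx⟩ := hZ
  refine ⟨x, fun g => eq_of_uniformity_basis uniformity_hasBasis_closed fun {U} hU => ?_⟩
  exact Set.mem_iInter.1 hx ⟨{g}, U, hU.1, hU.2⟩ g (Finset.mem_singleton_self g)

/-! ### Homogeneity of dense sets without colinear points -/

section Homogeneity

variable {n : ℕ} {D : Set (Fin n → ℚ)}

/-- The coordinate orders are linear up to ties, so they determine the product order. -/
theorem mem_autGroup_orderRel {g : Equiv.Perm D}
    (hg : ∀ (i : Fin n) (a b : D), a.1 i < b.1 i ↔ (g a).1 i < (g b).1 i) :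
    g ∈ autGroup (orderRel D) := by
  intro k a b
  induction k using Fin.cases with
  | zero =>
    simp only [orderRel, Fin.cons_zero, ne_eq, EmbeddingLike.apply_eq_iff_eq]
    refine and_congr_left fun _ => forall_congr' fun j => ?_
    rw [← not_lt, ← not_lt, hg j b a]
  | succ i =>
    simp only [orderRel, Fin.cons_succ]
    exact hg i a b

theorem autGroup_orderRel_lt_iff (g : autGroup (orderRel D)) (i : Fin n) (a b : D) :
    a.1 i < b.1 i ↔ (g.1 a).1 i < (g.1 b).1 i := by
  simpa only [orderRel, Fin.cons_succ] using g.2 i.succ a b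

/-- A finite relation between points of `D` is a partial isomorphism if it preserves and
reflects all coordinate orders. -/
def IsPartialIso (f : Finset (D × D)) : Prop :=
  ∀ p ∈ f, ∀ q ∈ f, ∀ i : Fin n, p.1.1 i < q.1.1 i ↔ p.2.1 i < q.2.1 i

theorem NoColinear.injective (hcol : NoColinear D) (i : Fin n) :
    Function.Injective fun a : D => a.1 i := by
  intro a b hab
  by_contra hne
  exact hcol a.1 a.2 b.1 b.2 (fun h => hne (Subtype.ext h)) i hab

theorem IsPartialIso.fst_eq_iff [NeZero n] (hcol : NoColinear D) {f : Finset (D × D)}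
    (hf : IsPartialIso f) {p q : D × D} (hp : p ∈ f) (hq : q ∈ f) : p.1 = q.1 ↔ p.2 = q.2 := by
  have h1 := hf p hp q hq 0
  have h2 := hf q hq p hp 0
  rw [← (hcol.injective 0).eq_iff, ← (hcol.injective 0).eq_iff (a := p.2)]
  simp only [le_antisymm_iff, ← not_lt, h1, h2]

theorem exists_mem_between_finsets (hdense : Dense D) (lo hi : Fin n → Finset ℚ)
    (h : ∀ i, ∀ x ∈ lo i, ∀ y ∈ hi i, x < y) :
    ∃ z : D, ∀ i, (∀ x ∈ lo i, x < z.1 i) ∧ ∀ y ∈ hi i, z.1 i < y := by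
  choose m hm using fun i => Order.exists_between_finsets (lo i) (hi i) (h i)
  have hopen : IsOpen (Set.univ.pi fun i : Fin n =>
      (⋂ x ∈ lo i, Set.Ioi x) ∩ ⋂ y ∈ hi i, Set.Iio y) :=
    isOpen_set_pi Set.finite_univ fun i _ =>
      (isOpen_biInter_finset fun _ _ => isOpen_Ioi).inter
        (isOpen_biInter_finset fun _ _ => isOpen_Iio)
  obtain ⟨z, hz, hzD⟩ := hdense.inter_open_nonempty _ hopen
    ⟨m, by simpa [Set.mem_pi] using hm⟩
  refine ⟨⟨z, hzD⟩, fun i => ?_⟩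
  simpa [Set.mem_pi] using hz i trivial

/-- A new point shares no coordinate with the domain, so its image is constrained only to an open
box; this is non-empty because `f` preserves each order, and density gives a point of `D` in it. -/
theorem IsPartialIso.exists_insert [NeZero n] (hdense : Dense D) (hcol : NoColinear D)
    [DecidableEq D] {f : Finset (D × D)} (hf : IsPartialIso f) (x : D) :
    ∃ y : D, IsPartialIso (insert (x, y) f) := by
  classical
  by_cases hx : ∃ p ∈ f, p.1 = x
  · obtain ⟨p, hp, rfl⟩ := hx
    exact ⟨p.2, by rwa [Prod.mk.eta, Finset.insert_eq_of_mem hp]⟩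
  push Not at hx
  have hne : ∀ p ∈ f, ∀ i, p.1.1 i ≠ x.1 i :=
    fun p hp i h => hx p hp (hcol.injective i h)
  obtain ⟨y, hy⟩ := exists_mem_between_finsets hdense
    (fun i => (f.filter fun p : D × D => p.1.1 i < x.1 i).image fun p : D × D => p.2.1 i)
    (fun i => (f.filter fun p : D × D => x.1 i < p.1.1 i).image fun p : D × D => p.2.1 i) (by
      simp only [Finset.mem_image, Finset.mem_filter]
      rintro i _ ⟨p, ⟨hp, hpx⟩, rfl⟩ _ ⟨q, ⟨hq, hqx⟩, rfl⟩
      exact (hf p hp q hq i).1 (hpx.trans hqx))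
  have hlo : ∀ p ∈ f, ∀ i, p.1.1 i < x.1 i → p.2.1 i < y.1 i := fun p hp i h =>
    (hy i).1 _ (Finset.mem_image_of_mem _ (Finset.mem_filter.2 ⟨hp, h⟩))
  have hhi : ∀ p ∈ f, ∀ i, x.1 i < p.1.1 i → y.1 i < p.2.1 i := fun p hp i h =>
    (hy i).2 _ (Finset.mem_image_of_mem _ (Finset.mem_filter.2 ⟨hp, h⟩))
  refine ⟨y, fun p hp q hq i => ?_⟩
  rcases Finset.mem_insert.1 hp with rfl | hp <;> rcases Finset.mem_insert.1 hq with rfl | hq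
  · simp
  · refine ⟨hhi q hq i, fun h => ?_⟩
    rcases (hne q hq i).lt_or_gt with h' | h'
    · exact absurd h (hlo q hq i h').not_gt
    · exact h'
  · refine ⟨hlo p hp i, fun h => ?_⟩
    rcases (hne p hp i).lt_or_gt with h' | h'
    · exact h'
    · exact absurd h (hhi p hp i h').not_gt
  · exact hf p hp q hq i

theorem IsPartialIso.swap [DecidableEq D] {f : Finset (D × D)} (hf : IsPartialIso f) :
    IsPartialIso (f.image Prod.swap) := by
  intro p' hp' q' hq' i
  obtain ⟨p, hp, rfl⟩ := Finset.mem_image.1 hp'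
  obtain ⟨q, hq, rfl⟩ := Finset.mem_image.1 hq'
  exact (hf p hp q hq i).symm

/-- Every finite partial isomorphism extends to an automorphism. -/
theorem IsPartialIso.exists_autGroup [NeZero n] (hdense : Dense D) (hcol : NoColinear D)
    {f : Finset (D × D)} (hf : IsPartialIso f) :
    ∃ g : autGroup (orderRel D), ∀ p ∈ f, g.1 p.1 = p.2 := by
  classical
  have hdom (x : D) : ∃ C : Order.Cofinal {f : Finset (D × D) // IsPartialIso f},
      ∀ f ∈ C, ∃ y, (x, y) ∈ f.1 :=
    ⟨⟨{f | ∃ y, (x, y) ∈ f.1}, fun f => by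
      obtain ⟨y, hy⟩ := f.2.exists_insert hdense hcol x
      exact ⟨⟨_, hy⟩, ⟨y, Finset.mem_insert_self _ _⟩, Finset.subset_insert _ _⟩⟩, fun _ h => h⟩
  have hcod (y : D) : ∃ C : Order.Cofinal {f : Finset (D × D) // IsPartialIso f},
      ∀ f ∈ C, ∃ x, (x, y) ∈ f.1 :=
    ⟨⟨{f | ∃ x, (x, y) ∈ f.1}, fun f => by
      obtain ⟨x, hx⟩ := f.2.swap.exists_insert hdense hcol y
      refine ⟨⟨_, hx.swap⟩, ⟨x, ?_⟩, fun p hp => ?_⟩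
      · exact Finset.mem_image.2 ⟨(y, x), Finset.mem_insert_self _ _, rfl⟩
      · exact Finset.mem_image.2 ⟨p.swap,
          Finset.mem_insert_of_mem (Finset.mem_image_of_mem _ hp), rfl⟩⟩, fun _ h => h⟩
  choose Cd hCd using hdom
  choose Cc hCc using hcod
  have : Countable D := inferInstance
  let _ := Encodable.ofCountable D
  -- Back-and-forth: the ideal meets the requirement of each point to lie in the domain and in the
  -- range.
  let C : D ⊕ D → Order.Cofinal {f : Finset (D × D) // IsPartialIso f} := Sum.elim Cd Cc
  let I := Order.idealOfCofinals ⟨f, hf⟩ C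
  have hI1 (x : D) : ∃ y, ∃ f ∈ I, (x, y) ∈ f.1 := by
    obtain ⟨f, hfC, hfI⟩ := Order.cofinal_meets_idealOfCofinals ⟨f, hf⟩ C (Sum.inl x)
    obtain ⟨y, hy⟩ := hCd x f hfC
    exact ⟨y, f, hfI, hy⟩
  have hI2 (y : D) : ∃ x, ∃ f ∈ I, (x, y) ∈ f.1 := by
    obtain ⟨f, hfC, hfI⟩ := Order.cofinal_meets_idealOfCofinals ⟨f, hf⟩ C (Sum.inr y)
    obtain ⟨x, hx⟩ := hCc y f hfC
    exact ⟨x, f, hfI, hx⟩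
  have hcommon {p q : D × D} (hp : ∃ f ∈ I, p ∈ f.1) (hq : ∃ f ∈ I, q ∈ f.1) :
      ∃ f : Finset (D × D), IsPartialIso f ∧ p ∈ f ∧ q ∈ f := by
    obtain ⟨f₁, h₁, hp⟩ := hp
    obtain ⟨f₂, h₂, hq⟩ := hq
    obtain ⟨f₃, _, h13, h23⟩ := I.directed f₁ h₁ f₂ h₂
    exact ⟨f₃.1, f₃.2, h13 hp, h23 hq⟩
  have heq {p q : D × D} (hp : ∃ f ∈ I, p ∈ f.1) (hq : ∃ f ∈ I, q ∈ f.1) :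
      p.1 = q.1 ↔ p.2 = q.2 := by
    obtain ⟨f, hf, hpf, hqf⟩ := hcommon hp hq
    exact hf.fst_eq_iff hcol hpf hqf
  choose u hu using hI1
  choose v hv using hI2
  let g : Equiv.Perm D :=
    { toFun := u
      invFun := v
      left_inv := fun x => (heq (hv (u x)) (hu x)).2 rfl
      right_inv := fun y => (heq (hu (v y)) (hv y)).1 rfl }
  refine ⟨⟨g, mem_autGroup_orderRel fun i a b => ?_⟩, fun p hp => ?_⟩
  · obtain ⟨f, hf, ha, hb⟩ := hcommon (hu a) (hu b)
    exact hf _ ha _ hb i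
  · exact (heq (hu p.1) ⟨⟨f, hf⟩, Order.mem_idealOfCofinals _ _, hp⟩).1 rfl

end Homogeneity

/-! ### The Ramsey property of dense sets without colinear points -/

theorem exists_equiv_fin_lt_iff {α β : Type*} [Fintype α] [LinearOrder β] {f : α → β}
    (hf : Function.Injective f) :
    ∃ r : α ≃ Fin (Fintype.card α), ∀ x y, r x < r y ↔ f x < f y := by
  let _ : LinearOrder α := LinearOrder.lift' f hf
  exact ⟨(monoEquivOfFin α rfl).symm.toEquiv, fun x y => (monoEquivOfFin α rfl).symm.lt_iff_lt⟩

theorem finProdFinEquiv_lt_iff {n a : ℕ} (i : Fin n) (r s : Fin a) :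
    finProdFinEquiv (i, r) < finProdFinEquiv (i, s) ↔ r < s := by
  rw [Fin.lt_def, Fin.lt_def, finProdFinEquiv_apply_val, finProdFinEquiv_apply_val]
  exact Nat.add_lt_add_iff_right

/-- Strictly monotone maps between blocks, put together. -/
theorem strictMono_finProdFinEquiv_conj {n a b : ℕ} {φ : Fin n → Fin a → Fin b}
    (hφ : ∀ i, StrictMono (φ i)) :
    StrictMono fun u : Fin (n * a) =>
      finProdFinEquiv ((finProdFinEquiv.symm u).1, φ (finProdFinEquiv.symm u).1
        (finProdFinEquiv.symm u).2) := by
  intro u v huv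
  obtain ⟨⟨i, r⟩, rfl⟩ := finProdFinEquiv.surjective u
  obtain ⟨⟨j, s⟩, rfl⟩ := finProdFinEquiv.surjective v
  simp only [Equiv.symm_apply_apply]
  rcases lt_trichotomy i j with h | rfl | h
  · rw [Fin.lt_def, finProdFinEquiv_apply_val, finProdFinEquiv_apply_val]
    have := (φ i r).2
    have h' : (i : ℕ) + 1 ≤ j := h
    nlinarith [Nat.mul_le_mul_left b h']
  · rw [finProdFinEquiv_lt_iff] at huv ⊢
    exact hφ i huv
  · rw [Fin.lt_def, finProdFinEquiv_apply_val, finProdFinEquiv_apply_val] at huv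
    have := s.2
    have h' : (j : ℕ) + 1 ≤ i := h
    nlinarith [Nat.mul_le_mul_left a h']

/-- Density gives a point of `D` in each open unit cube with corner `m`. -/
theorem exists_grid {n : ℕ} {D : Set (Fin n → ℚ)} (hdense : Dense D) :
    ∃ d : (Fin n → ℕ) → D, ∀ i m m', m i < m' i → (d m).1 i < (d m').1 i := by
  choose d hd using fun m : Fin n → ℕ => exists_mem_between_finsets hdense
    (fun i => {(m i : ℚ)}) (fun i => {(m i : ℚ) + 1}) (by simp)
  refine ⟨d, fun i m m' h => ?_⟩
  have h1 := (hd m i).2 _ (Finset.mem_singleton_self _)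
  have h2 := (hd m' i).1 _ (Finset.mem_singleton_self _)
  have h3 : (m i : ℚ) + 1 ≤ m' i := by exact_mod_cast h
  linarith

theorem exists_constant_translate {n : ℕ} [NeZero n] {D : Set (Fin n → ℚ)} (hdense : Dense D)
    (hcol : NoColinear D) (S : Finset D) (F : Finset (autGroup (orderRel D))) {κ : Type*}
    [Finite κ] (c : autGroup (orderRel D) → κ)
    (hc : ∀ g g' : autGroup (orderRel D), (∀ a ∈ S, g.1 a = g'.1 a) → c g = c g') :
    ∃ (h : autGroup (orderRel D)) (q : κ), ∀ g ∈ F, c (h * g) = q := by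
  classical
  let B : Finset D := F.biUnion fun g => S.image g.1
  have hB : ∀ g ∈ F, ∀ x ∈ S, g.1 x ∈ B := fun g hg x hx =>
    Finset.mem_biUnion.2 ⟨g, hg, Finset.mem_image_of_mem _ hx⟩
  choose ρ hρ using fun i => exists_equiv_fin_lt_iff
    ((hcol.injective i).comp (Subtype.val_injective (p := (· ∈ S))))
  choose σ hσ using fun i => exists_equiv_fin_lt_iff
    ((hcol.injective i).comp (Subtype.val_injective (p := (· ∈ B))))
  obtain ⟨d, hd⟩ := exists_grid hdense
  -- Block `i` of `w` supplies the `i`th grid indices, assigned by rank in the `i`th order.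
  let e (w : Fin (n * Fintype.card S) → ℕ) (x : S) : D :=
    d fun i => w (finProdFinEquiv (i, ρ i x))
  obtain ⟨t, q, ht, htq⟩ := exists_homogeneous_strictMono (n * Fintype.card S)
    (n * Fintype.card B) fun w =>
      -- The default `c 1` is irrelevant: the index sets used below all come from some `h * g`.
      if hw : ∃ g : autGroup (orderRel D), ∀ x : S, g.1 x = e w x then c hw.choose else c 1
  let E (y : B) : D := d fun i => t (finProdFinEquiv (i, σ i y))
  have hE : ∀ i (y z : B), y.1.1 i < z.1.1 i → (E y).1 i < (E z).1 i := by
    intro i y z hyz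
    refine hd i _ _ (ht ?_)
    exact (finProdFinEquiv_lt_iff i _ _).2 ((hσ i y z).2 hyz)
  have hiso : IsPartialIso (B.attach.image fun y => (y.1, E y)) := by
    intro p hp p' hp' i
    obtain ⟨y, _, rfl⟩ := Finset.mem_image.1 hp
    obtain ⟨z, _, rfl⟩ := Finset.mem_image.1 hp'
    refine ⟨hE i y z, fun h => ?_⟩
    rcases lt_trichotomy (y.1.1 i) (z.1.1 i) with h' | h' | h'
    · exact h'
    · obtain rfl : y = z := Subtype.ext (hcol.injective i h')
      exact absurd h (lt_irrefl _)
    · exact absurd h (hE i z y h').not_gt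
  obtain ⟨h, hh⟩ := hiso.exists_autGroup hdense hcol
  have hhE : ∀ y : B, h.1 y.1 = E y := fun y =>
    hh (y.1, E y) (Finset.mem_image_of_mem _ (Finset.mem_attach _ y))
  refine ⟨h, q, fun g hg => ?_⟩
  -- The effect of `g` on `i`th ranks, from `S` into `B`; it is increasing because `g` preserves the
  -- `i`th order.
  let φ (i : Fin n) (r : Fin (Fintype.card S)) : Fin (Fintype.card B) :=
    σ i ⟨g.1 ((ρ i).symm r).1, hB g hg _ ((ρ i).symm r).2⟩
  have hφ : ∀ i, StrictMono (φ i) := by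
    intro i r s hrs
    refine (hσ i _ _).2 ((autGroup_orderRel_lt_iff g i _ _).1 ((hρ i _ _).1 ?_))
    simpa using hrs
  have hs := htq _ (strictMono_finProdFinEquiv_conj hφ)
  have hw : ∀ x : S, (h * g).1 x.1 = e (t ∘ fun u : Fin (n * Fintype.card S) =>
      finProdFinEquiv ((finProdFinEquiv.symm u).1, φ (finProdFinEquiv.symm u).1
        (finProdFinEquiv.symm u).2)) x := by
    intro x
    change h.1 (g.1 x.1) = _
    rw [hhE ⟨g.1 x.1, hB g hg _ x.2⟩]
    simp only [E, e, φ, Function.comp_apply, Equiv.symm_apply_apply]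
  have hex : ∃ g' : autGroup (orderRel D), ∀ x : S, g'.1 x.1 = e (t ∘ _) x := ⟨h * g, hw⟩
  rw [dif_pos hex] at hs
  rw [← hs]
  exact hc _ _ fun a ha => (hw ⟨a, ha⟩).trans (hex.choose_spec ⟨a, ha⟩).symm

theorem corollary5p5 (n : ℕ) (hn : 2 ≤ n) (D : Set (Fin n → ℚ)) (hdense : Dense D)
    (hcol : NoColinear D) : ExtremelyAmenable.{0, v} (autGroup (orderRel D)) := by
  have : NeZero n := ⟨by omega⟩
  exact extremelyAmenable_autGroup_of_ramsey (orderRel D)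
    fun S F _ _ c hc => exists_constant_translate hdense hcol S F c hc
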